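/- Let $G=(V,E)$ be a finite, simple, connected graph. A spanning tree of $G$ is a maximal acyclic set of edges. For edge weights $c\in\mathbb{R}_{>0}^E$ the relative resistance of $e\in E$ and the resistance curvature of $v\in V$ are $$r_e(c)=\frac{\sum_{T\ni e}\prod_{t\in T}c_t}{\sum_{T}\prod_{t\in T}c_t},\qquad p_v(c)=1-\tfrac12\sum_{uv\in E}r_{uv}(c),$$ where $T$ runs over the spanning trees of $G$. The graph $G$ is resistance nonnegative (RN) if there are weights $c>0$ with $p_v(c)\ge 0$ for all $v\in V$, and resistance positive (RP) if there are weights $c>0$ with $p_v(c)>0$ for all $v\in V$. For $W\subseteq V$ let $\partial W=\{v\in V\setminus W\mid uv\in E\text{ for some }u\in W\}$. For $U\subseteq V$, the Kron reduction $\operatorname{kron}_U(G)$ is the graph on $V\setminus U$ obtained from $G$ by removing $U$ and adding, for every connected component $C$ of the induced subgraph $G[U]$, all possible edges between vertices of $\partial C$. (Equivalently, it is obtained by removing the vertices of $U$ one at a time, in any order, each time adding all possible edges between the neighbours of the removed vertex.) Proposition. Let $U\subseteq V$. If $G$ is RN, then $\operatorname{kron}_U(G)$ is RN. If $G$ is RP,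 then $\operatorname{kron}_U(G)$ is RP. (If $U=V$, the reduction is the empty graph and both properties hold vacuously.) -/

import Mathlib

namespace ResistanceGraph

/-- `T` is a spanning tree of `G`: a maximal acyclic set of edges of `G`. -/
def IsSpanningTree {V : Type*} (G : SimpleGraph V) (T : Finset (Sym2 V)) : Prop :=
  Maximal (fun S : Finset (Sym2 V) =>
    (S : Set (Sym2 V)) ⊆ G.edgeSet ∧
      (SimpleGraph.fromEdgeSet (S : Set (Sym2 V))).IsAcyclic) T

/-- The finite set of all spanning trees of `G`. -/
noncomputable def spanningTrees {V : Type*} [Finite V] (G : SimpleGraph V) :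
    Finset (Finset (Sym2 V)) :=
  (Set.toFinite {T : Finset (Sym2 V) | IsSpanningTree G T}).toFinset

/-- The spanning trees of `G` that contain the edge `e`. -/
noncomputable def spanningTreesThrough {V : Type*} [Finite V] (G : SimpleGraph V)
    (e : Sym2 V) : Finset (Finset (Sym2 V)) :=
  (Set.toFinite {T : Finset (Sym2 V) | IsSpanningTree G T ∧ e ∈ T}).toFinset

/-- Relative resistance `r_e(c)` of the edge `e`. Only the values of `c` on edges matter. -/
noncomputable def relativeResistance {V : Type*} [Finite V] (G : SimpleGraph V)
    (c : Sym2 V → ℝ) (e : Sym2 V) : ℝ :=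
  (∑ T ∈ spanningTreesThrough G e, ∏ t ∈ T, c t) / ∑ T ∈ spanningTrees G, ∏ t ∈ T, c t

/-- Resistance curvature `p_v(c) = 1 - (1/2) ∑_{uv ∈ E} r_{uv}(c)`. -/
noncomputable def curvature {V : Type*} [Finite V] (G : SimpleGraph V)
    (c : Sym2 V → ℝ) (v : V) : ℝ :=
  1 - (1 / 2) * ∑ e ∈ (Set.toFinite (G.incidenceSet v)).toFinset, relativeResistance G c e

/-- Resistance nonnegative (RN). -/
def IsRN {V : Type*} [Finite V] (G : SimpleGraph V) : Prop :=
  ∃ c : Sym2 V → ℝ, (∀ e ∈ G.edgeSet, 0 < c e) ∧ ∀ v, 0 ≤ curvature G c v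

/-- Resistance positive (RP). -/
def IsRP {V : Type*} [Finite V] (G : SimpleGraph V) : Prop :=
  ∃ c : Sym2 V → ℝ, (∀ e ∈ G.edgeSet, 0 < c e) ∧ ∀ v, 0 < curvature G c v

/-- `∂W`: the vertices outside `W` that have a neighbour in `W`. -/
def boundary {V : Type*} (G : SimpleGraph V) (W : Set V) : Set V :=
  {v | v ∉ W ∧ ∃ u ∈ W, G.Adj u v}

/-- The Kron reduction of `U` in `G`: remove `U`, and for every connected component `C` of the
subgraph induced on `U` add all possible edges between vertices of `∂C`. When the subgraph induced
on `U` is connected, this adds all possible edges between vertices of `∂U`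
(`kron_adj_of_connected`); in general it is the result of reducing the vertices of `U` one after
the other (`kron_insert_adj`). -/
def kron {V : Type*} (G : SimpleGraph V) (U : Set V) : SimpleGraph {v : V // v ∉ U} where
  Adj u v := u ≠ v ∧ (G.Adj u v ∨ ∃ C : (G.induce U).ConnectedComponent,
    (u : V) ∈ boundary G (Subtype.val '' C.supp) ∧ (v : V) ∈ boundary G (Subtype.val '' C.supp))
  symm := ⟨fun _ _ h => ⟨h.1.symm, h.2.imp (fun a => a.symm) (fun ⟨C, a, b⟩ => ⟨C, b, a⟩)⟩⟩
  loopless := ⟨fun _ h => h.1 rfl⟩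

/-- `a` and `b` lie in `U`, in the same component of the subgraph induced on `U`. -/
def LinkedIn {V : Type*} (G : SimpleGraph V) (U : Set V) (a b : V) : Prop :=
  ∃ (ha : a ∈ U) (hb : b ∈ U), (G.induce U).Reachable ⟨a, ha⟩ ⟨b, hb⟩

theorem kron_adj_iff {V : Type*} (G : SimpleGraph V) (U : Set V) (u v : {v : V // v ∉ U}) :
    (kron G U).Adj u v ↔ u ≠ v ∧ (G.Adj u v ∨ ∃ a b : V, G.Adj a u ∧ G.Adj b v ∧
      LinkedIn G U a b) := by
  refine and_congr_right fun _ => or_congr_right ⟨?_, ?_⟩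
  · rintro ⟨C, ⟨_, a, ⟨⟨a', ha⟩, haC, rfl⟩, hau⟩, ⟨_, b, ⟨⟨b', hb⟩, hbC, rfl⟩, hbv⟩⟩
    exact ⟨a', b', hau, hbv, ha, hb,
      SimpleGraph.ConnectedComponent.exact (haC.trans hbC.symm)⟩
  · rintro ⟨a, b, hau, hbv, ha, hb, hr⟩
    refine ⟨(G.induce U).connectedComponentMk ⟨a, ha⟩, ⟨?_, a, ⟨⟨a, ha⟩, rfl, rfl⟩, hau⟩,
      ⟨?_, b, ⟨⟨b, hb⟩, (SimpleGraph.ConnectedComponent.sound hr).symm, rfl⟩, hbv⟩⟩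
    · rintro ⟨z, -, hz⟩; exact u.2 (hz ▸ z.2)
    · rintro ⟨z, -, hz⟩; exact v.2 (hz ▸ z.2)

/-- If `U` induces a connected subgraph, `kron G U` is obtained by removing `U` and adding all
possible edges between vertices of `∂U`. -/
theorem kron_adj_of_connected {V : Type*} (G : SimpleGraph V) (U : Set V)
    (hU : (G.induce U).Connected) (u v : {v : V // v ∉ U}) :
    (kron G U).Adj u v ↔
      u ≠ v ∧ (G.Adj u v ∨ ((u : V) ∈ boundary G U ∧ (v : V) ∈ boundary G U)) := by
  rw [kron_adj_iff]
  refine and_congr_right fun _ => or_congr_right ⟨?_, ?_⟩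
  · rintro ⟨a, b, hau, hbv, ha, hb, -⟩
    exact ⟨⟨u.2, a, ha, hau⟩, ⟨v.2, b, hb, hbv⟩⟩
  · rintro ⟨⟨_, a, ha, hau⟩, ⟨_, b, hb, hbv⟩⟩
    exact ⟨a, b, hau, hbv, ha, hb, hU.preconnected _ _⟩

theorem LinkedIn.symm {V : Type*} {G : SimpleGraph V} {U : Set V} {a b : V}
    (h : LinkedIn G U a b) : LinkedIn G U b a :=
  let ⟨ha, hb, hr⟩ := h
  ⟨hb, ha, hr.symm⟩

theorem LinkedIn.trans {V : Type*} {G : SimpleGraph V} {U : Set V} {a b d : V}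
    (h : LinkedIn G U a b) (h' : LinkedIn G U b d) : LinkedIn G U a d :=
  let ⟨ha, _, hr⟩ := h
  let ⟨_, hd, hr'⟩ := h'
  ⟨ha, hd, hr.trans hr'⟩

theorem LinkedIn.refl {V : Type*} (G : SimpleGraph V) {U : Set V} {a : V} (ha : a ∈ U) :
    LinkedIn G U a a := ⟨ha, ha, SimpleGraph.Reachable.refl _⟩

theorem LinkedIn.of_adj {V : Type*} {G : SimpleGraph V} {U : Set V} {a b : V}
    (ha : a ∈ U) (hb : b ∈ U) (h : G.Adj a b) : LinkedIn G U a b :=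
  ⟨ha, hb, SimpleGraph.Adj.reachable (by simpa using h)⟩

theorem LinkedIn.mono {V : Type*} {G : SimpleGraph V} {U W : Set V} (hUW : U ⊆ W) {a b : V}
    (h : LinkedIn G U a b) : LinkedIn G W a b :=
  let ⟨ha, hb, hr⟩ := h
  ⟨hUW ha, hUW hb, hr.map (SimpleGraph.induceHomOfLE G hUW).toHom⟩

theorem LinkedIn.of_insert {V : Type*} {G : SimpleGraph V} {U : Set V} {x : V} (hx : x ∉ U)
    {a b : V} (h : LinkedIn G (insert x U) a b) :
    LinkedIn G U a b ∨ ((a = x ∨ ∃ d, LinkedIn G U a d ∧ G.Adj d x) ∧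
      (b = x ∨ ∃ d, LinkedIn G U b d ∧ G.Adj d x)) := by
  obtain ⟨ha, hb, ⟨w⟩⟩ := h
  suffices H : ∀ (p q : ↥(insert x U)) (_ : (G.induce (insert x U)).Walk p q),
      LinkedIn G U p q ∨ (((p : V) = x ∨ ∃ d, LinkedIn G U p d ∧ G.Adj d x) ∧
      ((q : V) = x ∨ ∃ d, LinkedIn G U q d ∧ G.Adj d x)) from H _ _ w
  intro p q w
  induction w with
  | @nil p =>
    rcases p.2 with hp | hp
    · exact Or.inr ⟨Or.inl hp, Or.inl hp⟩
    · exact Or.inl (LinkedIn.refl G hp)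
  | @cons p p' q hadj w ih =>
    have hadj : G.Adj p p' := by simpa using hadj
    rcases p.2 with hp | hp
    · refine Or.inr ⟨Or.inl hp, ?_⟩
      rcases ih with h | h
      · exact Or.inr ⟨p', h.symm, by rw [hp] at hadj; exact hadj.symm⟩
      · exact h.2
    · rcases p'.2 with hp' | hp'
      · rcases ih with h | h
        · exact absurd (hp' ▸ h.1) hx
        · exact Or.inr ⟨Or.inr ⟨p, LinkedIn.refl G hp, by rw [hp'] at hadj; exact hadj⟩, h.2⟩
      · have h1 := LinkedIn.of_adj hp hp' hadj
        rcases ih with h | ⟨h | ⟨d, h, hd⟩, h2⟩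
        · exact Or.inl (h1.trans h)
        · exact absurd (h ▸ hp') hx
        · exact Or.inr ⟨Or.inr ⟨d, h1.trans h, hd⟩, h2⟩

/-- Quotient property: reducing `insert x U` is the same as reducing `U` and then `x`. -/
theorem kron_insert_adj {V : Type*} (G : SimpleGraph V) (U : Set V) (x : V) (hx : x ∉ U)
    (u v : {w : {v : V // v ∉ U} // w ∉ ({⟨x, hx⟩} : Set {v : V // v ∉ U})}) :
    (kron (kron G U) {⟨x, hx⟩}).Adj u v ↔
      (kron G (insert x U)).Adj
        ⟨u, fun h => h.elim (fun h => u.2 (Subtype.ext h)) u.1.2⟩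
        ⟨v, fun h => h.elim (fun h => v.2 (Subtype.ext h)) v.1.2⟩ := by
  obtain ⟨⟨u, huU⟩, hux⟩ := u
  obtain ⟨⟨v, hvU⟩, hvx⟩ := v
  have hux' : u ≠ x := fun h => hux (Subtype.ext h)
  have hvx' : v ≠ x := fun h => hvx (Subtype.ext h)
  have hsub : U ⊆ insert x U := Set.subset_insert x U
  rw [kron_adj_iff, kron_adj_iff]
  have hL : ∀ a b, LinkedIn (kron G U) {⟨x, hx⟩} a b ↔ a = ⟨x, hx⟩ ∧ b = ⟨x, hx⟩ := by
    intro a b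
    refine ⟨fun ⟨ha, hb, _⟩ => ⟨ha, hb⟩, ?_⟩
    rintro ⟨rfl, rfl⟩
    exact LinkedIn.refl _ rfl
  simp only [hL, ne_eq, Subtype.mk.injEq, kron_adj_iff]
  refine and_congr_right fun huv => ⟨?_, ?_⟩
  · rintro (⟨_, h | ⟨a, b, ha, hb, h⟩⟩ | ⟨_, _, h1, h2, rfl, rfl⟩)
    · exact Or.inl h
    · exact Or.inr ⟨a, b, ha, hb, h.mono hsub⟩
    · have key : ∀ w : V, (G.Adj x w ∨ ∃ a b, G.Adj a x ∧ G.Adj b w ∧ LinkedIn G U a b) →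
          ∃ b, G.Adj b w ∧ LinkedIn G (insert x U) x b := by
        rintro w (h | ⟨a, b, ha, hb, h⟩)
        · exact ⟨x, h, LinkedIn.refl G (Set.mem_insert x U)⟩
        · exact ⟨b, hb, (LinkedIn.of_adj (Set.mem_insert x U) (hsub h.1) ha.symm).trans
            (h.mono hsub)⟩
      obtain ⟨a, ha, h1⟩ := key u h1.2
      obtain ⟨b, hb, h2⟩ := key v h2.2
      exact Or.inr ⟨a, b, ha, hb, h1.symm.trans h2⟩
  · rintro (h | ⟨a, b, ha, hb, h⟩)
    · exact Or.inl ⟨huv, Or.inl h⟩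
    · rcases h.of_insert hx with h | ⟨h1, h2⟩
      · exact Or.inl ⟨huv, Or.inr ⟨a, b, ha, hb, h⟩⟩
      · have key : ∀ w p : V, G.Adj p w → (p = x ∨ ∃ d, LinkedIn G U p d ∧ G.Adj d x) →
            (G.Adj x w ∨ ∃ a b, G.Adj a x ∧ G.Adj b w ∧ LinkedIn G U a b) := by
          rintro w p hp (rfl | ⟨d, h, hd⟩)
          · exact Or.inl hp
          · exact Or.inr ⟨d, p, hd, hp, h.symm⟩
        refine Or.inr ⟨⟨x, hx⟩, ⟨x, hx⟩, ?_, ?_, rfl, rfl⟩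
        · exact ⟨fun h => hux' (congrArg Subtype.val h).symm, key u a ha h1⟩
        · exact ⟨fun h => hvx' (congrArg Subtype.val h).symm, key v b hb h2⟩

/-- A Kron reduction of a connected graph, other than the removal of all vertices, is connected. -/
theorem kron_connected {V : Type*} (G : SimpleGraph V) (hG : G.Connected) (U : Set V)
    (hU : U ≠ Set.univ) : (kron G U).Connected := by
  have hne : Nonempty {v : V // v ∉ U} := by
    obtain ⟨v, hv⟩ := (Set.ne_univ_iff_exists_notMem U).1 hU
    exact ⟨⟨v, hv⟩⟩
  refine { preconnected := fun u v => ?_, nonempty := hne }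
  -- along a walk from `p` to `v`, `p` is either a vertex reaching `v` or linked to such a vertex
  suffices H : ∀ (p q : V) (_ : G.Walk p q) (hq : q ∉ U),
      (∀ hp : p ∉ U, (kron G U).Reachable ⟨p, hp⟩ ⟨q, hq⟩) ∧
      (p ∈ U → ∃ (z : V) (hz : z ∉ U) (b : V), (kron G U).Reachable ⟨z, hz⟩ ⟨q, hq⟩ ∧
        G.Adj b z ∧ LinkedIn G U p b) by
    obtain ⟨w⟩ := hG.preconnected u.1 v.1
    exact (H _ _ w v.2).1 u.2
  intro p q w hq
  induction w with
  | nil => exact ⟨fun _ => SimpleGraph.Reachable.refl _, fun h => absurd h hq⟩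
  | @cons p p' q hadj w ih =>
    obtain ⟨ih1, ih2⟩ := ih hq
    by_cases hp' : p' ∈ U
    · obtain ⟨z, hz, b, hr, hb, hl⟩ := ih2 hp'
      refine ⟨fun hp => ?_, fun hp =>
        ⟨z, hz, b, hr, hb, (LinkedIn.of_adj hp hp' hadj).trans hl⟩⟩
      by_cases hpz : p = z
      · subst hpz; exact hr
      · refine SimpleGraph.Reachable.trans (SimpleGraph.Adj.reachable ?_) hr
        exact (kron_adj_iff G U _ _).2 ⟨fun h => hpz (congrArg Subtype.val h),
          Or.inr ⟨p', b, hadj.symm, hb, hl⟩⟩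
    · refine ⟨fun hp => ?_, fun hp => ⟨p', hp', p, ih1 hp', hadj, LinkedIn.refl G hp⟩⟩
      refine SimpleGraph.Reachable.trans (SimpleGraph.Adj.reachable ?_) (ih1 hp')
      exact (kron_adj_iff G U _ _).2 ⟨fun h => hadj.ne (congrArg Subtype.val h), Or.inl hadj⟩

end ResistanceGraph

/-!
Eliminating one vertex `x` of a weighted graph (the star-mesh transform
`c' a b = c a b + c x a * c x b / d`, with `d` the total weight at `x`) keeps all effective
resistances between the other vertices, and changes the resistance curvatures by
`p' a = p a + (c x a / d) * p x`. Hence it preserves both nonnegativity and positivity of the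
curvature (`IsKronWeight.starMesh`), and its support is the Kron reduction of `{x}`, so induction
on `U` gives the result for all `U` (`exists_isKronWeight`).

To see the change of curvature, fix a root `o ∉ U` and let `Γ` be the inverse of the Laplacian with
`1` added to the diagonal entry at `o`. Then `Γ o w = 1` for all `w`, so that `Γ` satisfies the
Green identity `∑ b, c a b * (Γ a w - Γ b w) = [a = w] - [a = o]`. The restriction of `Γ` to the
remaining vertices satisfies the same identity for the reduced weights, so one and the same `Γ`
serves throughout the induction. With the effective resistances `R a b = Γ a a + Γ b b - 2 Γ a b`
and `p a = 1 - (∑ b, c a b * R a b) / 2`, the Green identity at `x ≠ o` yields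
`∑ b, c x b * (R a x - R a b) = 2 p x` for every remaining `a ≠ x`, which is the formula for `p' a`.

The link with spanning trees is `relativeResistance_eq`: the relative resistance of an edge `ab` is
`c a b * R a b`. It follows from the matrix-tree theorem `det_groundedLaplacian` and the matrix
determinant lemma, as setting the weight of an edge to zero discards the spanning trees through it
and changes the Laplacian by a matrix of rank one. The matrix-tree theorem is proved with the
Cauchy–Binet formula `det_mul_eq_sum_powersetCard`, where the grounding of the Laplacian is encoded
by the loop at the root as an additional column of the incidence matrix.
-/

namespace ResistanceGraph

open Finset Matrix

/-! ### The Cauchy–Binet formula -/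

/-- Multilinear expansion of the determinant of a product in its rows. -/
theorem det_mul_eq_sum_fun {n ι R : Type*} [Fintype n] [DecidableEq n] [Fintype ι] [CommRing R]
    (A : Matrix n ι R) (B : Matrix ι n R) :
    (A * B).det = ∑ f : n → ι, (∏ i, A i (f i)) * (B.submatrix f id).det := by
  classical
  have h : A * B = fun i => ∑ j, A i j • B j := by
    ext i k
    simp [Matrix.mul_apply, Finset.sum_apply]
  have h2 := (Matrix.detRowAlternating (n := n) (R := R)).toMultilinearMap.map_sum
    (fun (i : n) (j : ι) => A i j • B j)
  rw [h]
  refine h2.trans (Finset.sum_congr rfl fun f _ => ?_)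
  exact (Matrix.detRowAlternating (n := n) (R := R)).toMultilinearMap.map_smul_univ
    (fun i => A i (f i)) (fun i => B (f i))

/-- The Cauchy–Binet formula; `g S` is an arbitrary enumeration of the set `S` of columns. -/
theorem det_mul_eq_sum_powersetCard {n ι R : Type*} [Fintype n] [DecidableEq n] [Fintype ι]
    [DecidableEq ι] [CommRing R] (A : Matrix n ι R) (B : Matrix ι n R) (g : Finset ι → n → ι)
    (hg : ∀ S : Finset ι, S.card = Fintype.card n →
      Function.Injective (g S) ∧ univ.image (g S) = S) :
    (A * B).det = ∑ S ∈ powersetCard (Fintype.card n) univ,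
      (A.submatrix id (g S)).det * (B.submatrix (g S) id).det := by
  classical
  rw [det_mul_eq_sum_fun]
  have hzero : ∀ f : n → ι, ¬ Function.Injective f →
      (∏ i, A i (f i)) * (B.submatrix f id).det = 0 := by
    intro f hf
    obtain ⟨i, j, hij, hne⟩ : ∃ i j, f i = f j ∧ i ≠ j := by
      simpa [Function.Injective] using hf
    rw [Matrix.det_zero_of_row_eq hne (by ext k; simp [hij]), mul_zero]
  rw [← Finset.sum_filter_of_ne (p := Function.Injective)
    (fun f _ h => by by_contra hf; exact h (hzero f hf))]
  rw [← Finset.sum_fiberwise_of_maps_to (t := powersetCard (Fintype.card n) univ)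
    (g := fun f : n → ι => univ.image f)
    (fun f hf => by
      simp only [mem_filter, mem_univ, true_and] at hf
      simp [mem_powersetCard, card_image_of_injective _ hf])]
  refine Finset.sum_congr rfl fun S hS => ?_
  obtain ⟨hinj, himg⟩ := hg S (mem_powersetCard.1 hS).2
  have hA : (A.submatrix id (g S)).det =
      ∑ σ : Equiv.Perm n, ((Equiv.Perm.sign σ : ℤ) : R) * ∏ i, A i (g S (σ i)) := by
    rw [← Matrix.det_transpose, Matrix.det_apply']
    rfl
  rw [hA, Finset.sum_mul]
  symm
  -- an injection with image `S` is `g S` composed with a unique permutation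
  refine Finset.sum_bij (fun σ _ => g S ∘ σ) ?_ ?_ ?_ ?_
  · intro σ _
    simp only [mem_filter, mem_univ, true_and]
    refine ⟨hinj.comp σ.injective, ?_⟩
    rw [← Finset.image_image, Finset.image_univ_equiv, himg]
  · intro σ _ τ _ h
    ext i
    exact hinj (congrFun h i)
  · intro f hf
    simp only [mem_filter, mem_univ, true_and] at hf
    have hex : ∀ i, ∃ j, g S j = f i := by
      intro i
      have : f i ∈ univ.image (g S) := by rw [himg, ← hf.2]; exact mem_image_of_mem _ (mem_univ i)
      simpa using this
    choose s hs using hex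
    have hsinj : Function.Injective s := fun i j h => hf.1 (by rw [← hs, ← hs, h])
    refine ⟨Equiv.ofBijective s (Finite.injective_iff_bijective.1 hsinj), mem_univ _, ?_⟩
    ext i
    exact hs i
  · intro σ _
    have : (B.submatrix (g S ∘ σ) id) = (B.submatrix (g S) id).submatrix σ id := rfl
    rw [this, Matrix.det_permute]
    simp only [Function.comp]
    ring

/-! ### Spanning trees -/

/-- In a connected graph the maximal acyclic sets of edges are the edge sets of spanning trees. -/
theorem isSpanningTree_iff_isTree {V : Type*} [Finite V] {G : SimpleGraph V} (hG : G.Connected)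
    (T : Finset (Sym2 V)) :
    IsSpanningTree G T ↔ (T : Set (Sym2 V)) ⊆ G.edgeSet ∧
      (SimpleGraph.fromEdgeSet (T : Set (Sym2 V))).IsTree := by
  have hle : ∀ S : Finset (Sym2 V), (S : Set (Sym2 V)) ⊆ G.edgeSet →
      SimpleGraph.fromEdgeSet (S : Set (Sym2 V)) ≤ G := by
    intro S hS a b hab
    exact hS hab.1
  -- `S ↦ fromEdgeSet S` is an order embedding on the sets of edges of `G`
  have hmono : ∀ S S' : Finset (Sym2 V), (S : Set (Sym2 V)) ⊆ G.edgeSet →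
      SimpleGraph.fromEdgeSet (S : Set (Sym2 V)) ≤ SimpleGraph.fromEdgeSet (S' : Set (Sym2 V)) →
      S ⊆ S' := by
    intro S S' hS h e
    induction e with
    | h a b =>
      intro he
      exact (h (show (SimpleGraph.fromEdgeSet (S : Set (Sym2 V))).Adj a b from
        ⟨he, G.ne_of_adj (hS he)⟩)).1
  constructor
  · intro h
    refine ⟨h.1.1, (hG.maximal_le_isAcyclic_iff_isTree (hle T h.1.1)).1
      ⟨⟨hle T h.1.1, h.1.2⟩, ?_⟩⟩
    intro H hH hTH
    have hS : ((Set.toFinite H.edgeSet).toFinset : Set (Sym2 V)) = H.edgeSet := by simp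
    have hfrom : SimpleGraph.fromEdgeSet
        ((Set.toFinite H.edgeSet).toFinset : Set (Sym2 V)) = H := by
      rw [hS, SimpleGraph.fromEdgeSet_edgeSet]
    have := h.2 (y := (Set.toFinite H.edgeSet).toFinset)
      ⟨by rw [hS]; exact SimpleGraph.edgeSet_mono hH.1, by rw [hfrom]; exact hH.2⟩
      (hmono _ _ h.1.1 (by rw [hfrom]; exact hTH))
    change H ≤ _
    rw [← hfrom]
    exact SimpleGraph.fromEdgeSet_mono (by exact_mod_cast this)
  · rintro ⟨hT, htree⟩
    have hmax := (hG.maximal_le_isAcyclic_iff_isTree (hle T hT)).2 htree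
    refine ⟨⟨hT, htree.isAcyclic⟩, fun S hS hTS => ?_⟩
    exact hmono _ _ hS.1 (hmax.2 ⟨hle S hS.1, hS.2⟩
      (SimpleGraph.fromEdgeSet_mono (by exact_mod_cast hTS)))

theorem fromEdgeSet_isTree_iff {V : Type*} [Fintype V] {G : SimpleGraph V}
    {T : Finset (Sym2 V)} (hT : (T : Set (Sym2 V)) ⊆ G.edgeSet) :
    (SimpleGraph.fromEdgeSet (T : Set (Sym2 V))).IsTree ↔
      (SimpleGraph.fromEdgeSet (T : Set (Sym2 V))).Connected ∧ T.card + 1 = Fintype.card V := by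
  have h : (SimpleGraph.fromEdgeSet (T : Set (Sym2 V))).edgeSet = T := by
    rw [SimpleGraph.edgeSet_fromEdgeSet]
    refine sdiff_eq_left.2 (Set.disjoint_left.2 fun e he hd => ?_)
    exact G.not_isDiag_of_mem_edgeSet (hT he) hd
  rw [SimpleGraph.isTree_iff_connected_and_card, h]
  simp

/-! ### The matrix-tree theorem -/

open Classical in
/-- The incidence matrix of the complete graph on `V`, with an arbitrary orientation of each edge,
grounded at the root `o`: the column of the loop `s(o, o)` is the basis vector at `o`. The columns
of the other loops vanish. -/
noncomputable def groundedIncidence {V : Type*} (o : V) : Matrix V (Sym2 V) ℤ := fun v e =>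
  if e = s(o, o) then Pi.single (M := fun _ => ℤ) o 1 v
  else Pi.single (M := fun _ => ℤ) e.out.1 1 v - Pi.single (M := fun _ => ℤ) e.out.2 1 v

section

variable {V : Type*} [DecidableEq V] (o : V)

theorem groundedIncidence_root (v : V) :
    groundedIncidence o v s(o, o) = Pi.single (M := fun _ => ℤ) o 1 v := by
  rw [groundedIncidence, if_pos rfl]
  congr!

theorem groundedIncidence_mk {a b : V} (h : s(a, b) ≠ s(o, o)) :
    (∀ v, groundedIncidence o v s(a, b) =
      Pi.single (M := fun _ => ℤ) a 1 v - Pi.single (M := fun _ => ℤ) b 1 v) ∨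
    (∀ v, groundedIncidence o v s(a, b) =
      Pi.single (M := fun _ => ℤ) b 1 v - Pi.single (M := fun _ => ℤ) a 1 v) := by
  have hout : s((s(a, b)).out.1, (s(a, b)).out.2) = s(a, b) := Quot.out_eq (s(a, b))
  have hdef : ∀ v, groundedIncidence o v s(a, b) =
      Pi.single (M := fun _ => ℤ) (s(a, b)).out.1 1 v -
        Pi.single (M := fun _ => ℤ) (s(a, b)).out.2 1 v := by
    intro v
    rw [groundedIncidence, if_neg h]
    congr!
  rcases Sym2.eq_iff.1 hout with ⟨h1, h2⟩ | ⟨h1, h2⟩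
  · left; intro v; rw [hdef, h1, h2]
  · right; intro v; rw [hdef, h1, h2]

variable [Fintype V]

/-- If the columns `g` do not contain the root loop, or do not connect the graph, their minor of
the grounded incidence matrix vanishes: the indicator of the vertices not reachable from the root
is orthogonal to all of them. -/
theorem det_groundedIncidence_eq_zero {S : Finset (Sym2 V)} {g : V → Sym2 V}
    (hg : univ.image g = S)
    (hS : ¬ (s(o, o) ∈ S ∧ (SimpleGraph.fromEdgeSet (S : Set (Sym2 V))).Connected)) :
    ((groundedIncidence o).submatrix id g).det = 0 := by
  classical
  suffices h : ∃ x : V → ℤ, x ≠ 0 ∧ (s(o, o) ∈ S → x o = 0) ∧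
      ∀ a b, s(a, b) ∈ S → x a = x b by
    obtain ⟨x, hx, hxo, hxe⟩ := h
    refine Matrix.exists_vecMul_eq_zero_iff.1 ⟨x, hx, ?_⟩
    ext i
    have hi : g i ∈ S := hg ▸ mem_image_of_mem g (mem_univ i)
    simp only [Matrix.vecMul, dotProduct, Matrix.submatrix_apply, id, Pi.zero_apply]
    generalize g i = e at hi
    induction e with
    | h a b =>
      by_cases he : s(a, b) = s(o, o)
      · rw [he]
        simp only [groundedIncidence_root, Pi.single_apply]
        simp [hxo (he ▸ hi)]
      · have := hxe a b hi
        rcases groundedIncidence_mk o he with h | h <;>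
          simp [h, Pi.single_apply, mul_sub, Finset.sum_sub_distrib, this]
  by_cases hroot : s(o, o) ∈ S
  · have hc : ¬ (SimpleGraph.fromEdgeSet (S : Set (Sym2 V))).Connected := fun h => hS ⟨hroot, h⟩
    have : ∃ v, ¬ (SimpleGraph.fromEdgeSet (S : Set (Sym2 V))).Reachable o v := by
      by_contra! h
      exact hc { preconnected := fun u v => (h u).symm.trans (h v), nonempty := ⟨o⟩ }
    obtain ⟨v, hv⟩ := this
    refine ⟨fun u => if (SimpleGraph.fromEdgeSet (S : Set (Sym2 V))).Reachable o u then 0 else 1,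
      fun h => ?_, fun _ => if_pos (SimpleGraph.Reachable.refl _), fun a b hab => ?_⟩
    · simpa [hv] using congrFun h v
    · rcases eq_or_ne a b with rfl | hne
      · rfl
      · have hadj : (SimpleGraph.fromEdgeSet (S : Set (Sym2 V))).Adj a b := ⟨hab, hne⟩
        have : (SimpleGraph.fromEdgeSet (S : Set (Sym2 V))).Reachable o a ↔
            (SimpleGraph.fromEdgeSet (S : Set (Sym2 V))).Reachable o b :=
          ⟨fun h => h.trans hadj.reachable, fun h => h.trans hadj.symm.reachable⟩
        simp only [this]
  · refine ⟨fun _ => 1, fun h => ?_, fun h => absurd h hroot, fun _ _ _ => rfl⟩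
    simpa using congrFun h o

/-- The minor of a connected set of `card V` columns containing the root loop is `±1`: following a
walk to the root shows that the columns span `ℤ ^ V`. -/
theorem det_groundedIncidence_sq {S : Finset (Sym2 V)} {g : V → Sym2 V}
    (hg : univ.image g = S) (hroot : s(o, o) ∈ S)
    (hS : (SimpleGraph.fromEdgeSet (S : Set (Sym2 V))).Connected) :
    ((groundedIncidence o).submatrix id g).det ^ 2 = 1 := by
  set A := (groundedIncidence o).submatrix id g with hA
  have hcol : ∀ e ∈ S, (fun v => groundedIncidence o v e) ∈ LinearMap.range A.mulVecLin := by
    intro e he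
    rw [← hg] at he
    obtain ⟨i, -, rfl⟩ := mem_image.1 he
    refine ⟨Pi.single i 1, ?_⟩
    ext v
    simp [hA]
  have ho : Pi.single (M := fun _ => ℤ) o 1 ∈ LinearMap.range A.mulVecLin := by
    have := hcol _ hroot
    rwa [funext (groundedIncidence_root o)] at this
  have hadj : ∀ a b, (SimpleGraph.fromEdgeSet (S : Set (Sym2 V))).Adj a b →
      Pi.single (M := fun _ => ℤ) a 1 - Pi.single (M := fun _ => ℤ) b 1 ∈
        LinearMap.range A.mulVecLin := by
    rintro a b ⟨hab, hne⟩
    have hne' : s(a, b) ≠ s(o, o) := by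
      intro h
      rcases Sym2.eq_iff.1 h with ⟨h1, h2⟩ | ⟨h1, h2⟩ <;> exact hne (h1.trans h2.symm)
    have := hcol _ hab
    rcases groundedIncidence_mk o hne' with h | h
    · rw [funext h] at this
      exact this
    · rw [funext h] at this
      rw [← neg_sub]
      exact neg_mem this
  have hwalk : ∀ a b, (SimpleGraph.fromEdgeSet (S : Set (Sym2 V))).Walk a b →
      Pi.single (M := fun _ => ℤ) b 1 ∈ LinearMap.range A.mulVecLin →
      Pi.single (M := fun _ => ℤ) a 1 ∈ LinearMap.range A.mulVecLin := by
    intro a b w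
    induction w with
    | nil => exact id
    | cons h _ ih =>
      intro hb
      have := add_mem (hadj _ _ h) (ih hb)
      rwa [sub_add_cancel] at this
  have hsurj : Function.Surjective A.mulVec := by
    intro x
    have : x ∈ LinearMap.range A.mulVecLin := by
      rw [pi_eq_sum_univ' x]
      refine sum_mem fun v _ => Submodule.smul_mem _ _ ?_
      obtain ⟨w⟩ := hS.preconnected v o
      have := hwalk v o w ho
      convert this using 1
    exact this
  exact Int.isUnit_sq ((Matrix.isUnit_iff_isUnit_det _).1
    (Matrix.mulVec_surjective_iff_isUnit.1 hsurj))

end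

open Classical in
/-- The weights of the columns of the grounded incidence matrix: `c` on the edges of `G`, `1` on
the root loop. -/
noncomputable def groundedWeight {V : Type*} (G : SimpleGraph V) (o : V) (c : Sym2 V → ℝ) :
    Sym2 V → ℝ := fun e => if e = s(o, o) then 1 else if e ∈ G.edgeSet then c e else 0

/-- The weighted Laplacian of `G`, with `1` added to the diagonal entry at the root `o`. -/
noncomputable def groundedLaplacian {V : Type*} [Fintype V] [DecidableEq V] (G : SimpleGraph V)
    (o : V) (c : Sym2 V → ℝ) : Matrix V V ℝ :=
  (groundedIncidence o).map ((↑) : ℤ → ℝ) *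
    (diagonal (groundedWeight G o c) * ((groundedIncidence o).map ((↑) : ℤ → ℝ))ᵀ)

theorem card_spanningTree {V : Type*} [Fintype V] {G : SimpleGraph V} (hG : G.Connected)
    {T : Finset (Sym2 V)} (hT : IsSpanningTree G T) : T.card + 1 = Fintype.card V :=
  have h := (isSpanningTree_iff_isTree hG T).1 hT
  ((fromEdgeSet_isTree_iff h.1).1 h.2).2

/-- The matrix-tree theorem. The nonzero terms of the Cauchy–Binet formula come from the sets
consisting of the root loop and a spanning tree. -/
theorem det_groundedLaplacian {V : Type*} [Fintype V] [DecidableEq V] {G : SimpleGraph V}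
    (hG : G.Connected) (o : V) (c : Sym2 V → ℝ) :
    (groundedLaplacian G o c).det = ∑ T ∈ spanningTrees G, ∏ t ∈ T, c t := by
  classical
  have hex : ∀ S : Finset (Sym2 V), ∃ g : V → Sym2 V, S.card = Fintype.card V →
      Function.Injective g ∧ univ.image g = S := by
    intro S
    by_cases h : S.card = Fintype.card V
    · have e : V ≃ S := Fintype.equivOfCardEq (by simp [h])
      refine ⟨fun v => e v, fun _ => ⟨Subtype.val_injective.comp e.injective, ?_⟩⟩
      ext x
      simp only [mem_image, mem_univ, true_and]
      exact ⟨fun ⟨v, hv⟩ => hv ▸ (e v).2, fun hx => ⟨e.symm ⟨x, hx⟩, by simp⟩⟩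
    · exact ⟨fun _ => s(o, o), fun h' => absurd h' h⟩
  choose g hg using hex
  have hloop : s(o, o) ∉ G.edgeSet := by simp
  rw [groundedLaplacian, det_mul_eq_sum_powersetCard _ _ g hg]
  have hterm : ∀ S ∈ powersetCard (Fintype.card V) (univ : Finset (Sym2 V)),
      (((groundedIncidence o).map ((↑) : ℤ → ℝ)).submatrix id (g S)).det *
        ((diagonal (groundedWeight G o c) *
          ((groundedIncidence o).map ((↑) : ℤ → ℝ))ᵀ).submatrix (g S) id).det =
      (∏ e ∈ S, groundedWeight G o c e) *
        ((((groundedIncidence o).submatrix id (g S)).det ^ 2 : ℤ) : ℝ) := by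
    intro S hS
    obtain ⟨hinj, himg⟩ := hg S (mem_powersetCard.1 hS).2
    have h1 : (((groundedIncidence o).map ((↑) : ℤ → ℝ)).submatrix id (g S)).det =
        (((groundedIncidence o).submatrix id (g S)).det : ℝ) := by
      rw [Matrix.submatrix_map]
      exact (RingHom.map_det (Int.castRingHom ℝ) _).symm
    have h2 : (diagonal (groundedWeight G o c) *
          ((groundedIncidence o).map ((↑) : ℤ → ℝ))ᵀ).submatrix (g S) id =
        diagonal (fun v => groundedWeight G o c (g S v)) *
          (((groundedIncidence o).map ((↑) : ℤ → ℝ)).submatrix id (g S))ᵀ := by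
      ext u v
      simp [Matrix.diagonal_mul]
    rw [h2, Matrix.det_mul, Matrix.det_diagonal, Matrix.det_transpose, h1]
    conv_rhs => rw [← himg, prod_image hinj.injOn, himg]
    push_cast
    ring
  rw [Finset.sum_congr rfl hterm]
  symm
  refine Finset.sum_bij_ne_zero (fun T _ _ => insert s(o, o) T) ?_ ?_ ?_ ?_
  · intro T hT _
    have hT' : IsSpanningTree G T := by simpa [spanningTrees] using hT
    rw [mem_powersetCard, card_insert_of_notMem fun h => hloop (hT'.1.1 h)]
    exact ⟨subset_univ _, card_spanningTree hG hT'⟩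
  · intro T hT _ T' hT' _ h
    have h1 : IsSpanningTree G T := by simpa [spanningTrees] using hT
    have h2 : IsSpanningTree G T' := by simpa [spanningTrees] using hT'
    rw [← erase_insert fun h => hloop (h1.1.1 h), h, erase_insert fun h => hloop (h2.1.1 h)]
  · intro S hS hne
    obtain ⟨hinj, himg⟩ := hg S (mem_powersetCard.1 hS).2
    have hconn : s(o, o) ∈ S ∧ (SimpleGraph.fromEdgeSet (S : Set (Sym2 V))).Connected := by
      by_contra h
      rw [det_groundedIncidence_eq_zero o himg h] at hne
      simp at hne
    have hw : ∀ e ∈ S.erase s(o, o), e ∈ G.edgeSet := by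
      intro e he
      by_contra h
      apply hne
      rw [prod_eq_zero (mem_of_mem_erase he), zero_mul]
      simp [groundedWeight, ne_of_mem_erase he, h]
    have hfrom : SimpleGraph.fromEdgeSet ((S.erase s(o, o) : Finset (Sym2 V)) : Set (Sym2 V)) =
        SimpleGraph.fromEdgeSet (S : Set (Sym2 V)) := by
      ext a b
      simp only [SimpleGraph.fromEdgeSet_adj, mem_coe, mem_erase]
      grind
    have htree : IsSpanningTree G (S.erase s(o, o)) := by
      rw [isSpanningTree_iff_isTree hG]
      refine ⟨fun e he => hw e he, (fromEdgeSet_isTree_iff fun e he => hw e he).2 ⟨?_, ?_⟩⟩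
      · rw [hfrom]; exact hconn.2
      · rw [card_erase_add_one hconn.1]; exact (mem_powersetCard.1 hS).2
    refine ⟨S.erase s(o, o), by simpa [spanningTrees] using htree, ?_, insert_erase hconn.1⟩
    rw [det_groundedIncidence_sq o himg hconn.1 hconn.2, ← mul_prod_erase _ _ hconn.1] at hne
    have hp : ∏ t ∈ S.erase s(o, o), c t =
        ∏ t ∈ S.erase s(o, o), groundedWeight G o c t :=
      prod_congr rfl fun e he => by simp [groundedWeight, ne_of_mem_erase he, hw e he]
    rw [hp]
    intro h0
    simp [h0] at hne
  · intro T hT _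
    have hT' : IsSpanningTree G T := by simpa [spanningTrees] using hT
    have hnot : s(o, o) ∉ T := fun h => hloop (hT'.1.1 h)
    have hcard : (insert s(o, o) T).card = Fintype.card V := by
      rw [card_insert_of_notMem hnot, card_spanningTree hG hT']
    have hconn : (SimpleGraph.fromEdgeSet
        ((insert s(o, o) T : Finset (Sym2 V)) : Set (Sym2 V))).Connected := by
      have h := ((isSpanningTree_iff_isTree hG T).1 hT').2.connected
      convert h using 1
      ext a b
      simp only [SimpleGraph.fromEdgeSet_adj, mem_coe, mem_insert]
      grind
    rw [det_groundedIncidence_sq o (hg _ hcard).2 (mem_insert_self _ _) hconn,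
      prod_insert hnot]
    have hp : ∏ t ∈ T, groundedWeight G o c t = ∏ t ∈ T, c t :=
      prod_congr rfl fun e he => by
        have h1 : e ≠ s(o, o) := fun h => hnot (h ▸ he)
        have h2 : e ∈ G.edgeSet := hT'.1.1 he
        simp [groundedWeight, h1, h2]
    rw [hp]
    simp [groundedWeight]

/-! ### Relative resistances and the Green matrix -/

open Classical in
/-- The edge weights `c` of `G`, as a function of two vertices that vanishes off the edges. -/
noncomputable def conductance {V : Type*} (G : SimpleGraph V) (c : Sym2 V → ℝ) (a b : V) : ℝ :=
  if G.Adj a b then c s(a, b) else 0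

/-- The effective resistance between `a` and `b` in terms of a Green matrix `Γ`, which is assumed
to be symmetric: `2 * Γ a b` stands for `Γ a b + Γ b a`. -/
def effectiveResistance {V : Type*} (Γ : V → V → ℝ) (a b : V) : ℝ := Γ a a + Γ b b - 2 * Γ a b

theorem conductance_comm {V : Type*} (G : SimpleGraph V) (c : Sym2 V → ℝ) (a b : V) :
    conductance G c a b = conductance G c b a := by
  by_cases h : G.Adj a b
  · rw [conductance, conductance, if_pos h, if_pos h.symm, Sym2.eq_swap]
  · rw [conductance, conductance, if_neg h, if_neg fun h' => h h'.symm]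

theorem groundedIncidence_eq_zero_of_notMem {V : Type*} [DecidableEq V] (o : V) {v : V} {e : Sym2 V} (h : v ∉ e) :
    groundedIncidence o v e = 0 := by
  induction e with
  | h x y =>
    have hx : v ≠ x := fun h' => h (h' ▸ Sym2.mem_mk_left x y)
    have hy : v ≠ y := fun h' => h (h' ▸ Sym2.mem_mk_right x y)
    by_cases he : s(x, y) = s(o, o)
    · have ho : v ≠ o := fun h' => h (by rw [he, h']; exact Sym2.mem_mk_left o o)
      rw [he, groundedIncidence_root, Pi.single_eq_of_ne ho]
    · rcases groundedIncidence_mk o he with h | h <;>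
        rw [h, Pi.single_eq_of_ne hx, Pi.single_eq_of_ne hy, sub_zero]

section

variable {V : Type*} [Fintype V] [DecidableEq V] {G : SimpleGraph V} (o : V) (c : Sym2 V → ℝ)

theorem groundedLaplacian_apply_eq_sum (a b : V) : groundedLaplacian G o c a b =
    ∑ e, (groundedIncidence o a e : ℝ) * (groundedWeight G o c e * groundedIncidence o b e) := by
  simp [groundedLaplacian, Matrix.mul_apply, Matrix.diagonal_apply]

theorem sum_groundedIncidence (e : Sym2 V) :
    ∑ v, groundedIncidence o v e = if e = s(o, o) then 1 else 0 := by
  split_ifs with he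
  · simp [he, groundedIncidence_root, Pi.single_apply]
  · induction e with
    | h x y =>
      rcases groundedIncidence_mk o he with h | h <;> simp [h, Pi.single_apply]

theorem groundedLaplacian_apply_of_ne {a b : V} (hab : a ≠ b) :
    groundedLaplacian G o c a b = -conductance G c a b := by
  rw [groundedLaplacian_apply_eq_sum, Finset.sum_eq_single s(a, b)]
  · have he : s(a, b) ≠ s(o, o) := by
      intro h
      rcases Sym2.eq_iff.1 h with ⟨h1, h2⟩ | ⟨h1, h2⟩ <;> exact hab (h1.trans h2.symm)
    have hw : groundedWeight G o c s(a, b) = conductance G c a b := by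
      rw [groundedWeight, if_neg he, conductance]
      congr
    rcases groundedIncidence_mk o he with h | h <;>
      simp [h, hw, hab, hab.symm]
  · intro e _ he
    by_cases ha : a ∈ e
    · by_cases hb : b ∈ e
      · exact absurd ((Sym2.mem_and_mem_iff hab).1 ⟨ha, hb⟩) he
      · simp [groundedIncidence_eq_zero_of_notMem o hb]
    · simp [groundedIncidence_eq_zero_of_notMem o ha]
  · simp

theorem sum_groundedLaplacian (a : V) :
    ∑ b, groundedLaplacian G o c a b = if a = o then 1 else 0 := by
  simp only [groundedLaplacian_apply_eq_sum]
  rw [Finset.sum_comm]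
  have : ∀ e, ∑ b, (groundedIncidence o a e : ℝ) *
      (groundedWeight G o c e * groundedIncidence o b e) =
      if e = s(o, o) then (if a = o then 1 else 0) else 0 := by
    intro e
    rw [← Finset.mul_sum, ← Finset.mul_sum]
    have h := congrArg (fun n : ℤ => (n : ℝ)) (sum_groundedIncidence o e)
    push_cast at h
    rw [h]
    split_ifs with h1 h2 <;> simp_all [groundedWeight, groundedIncidence_root]
  rw [Finset.sum_congr rfl fun e _ => this e]
  simp

/-- The action of the grounded Laplacian on a function, in the form of a weighted sum of
differences. -/
theorem sum_groundedLaplacian_mul (f : V → ℝ) (a : V) :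
    ∑ b, groundedLaplacian G o c a b * f b =
      ∑ b, conductance G c a b * (f a - f b) + if a = o then f a else 0 := by
  have h : ∀ b, groundedLaplacian G o c a b * f b =
      groundedLaplacian G o c a b * f a + conductance G c a b * (f a - f b) := by
    intro b
    rcases eq_or_ne a b with rfl | hab
    · simp
    · rw [groundedLaplacian_apply_of_ne o c hab]; ring
  rw [Finset.sum_congr rfl fun b _ => h b, Finset.sum_add_distrib, ← Finset.sum_mul,
    sum_groundedLaplacian, add_comm]
  simp

theorem groundedLaplacian_comm (a b : V) :
    groundedLaplacian G o c a b = groundedLaplacian G o c b a := by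
  simp only [groundedLaplacian_apply_eq_sum]
  exact Finset.sum_congr rfl fun e _ => by ring

/-- Setting the weight of an edge to zero is a rank one change of the grounded Laplacian. -/
theorem groundedLaplacian_update {e : Sym2 V} (he : e ∈ G.edgeSet) :
    groundedLaplacian G o (Function.update c e 0) = groundedLaplacian G o c +
      replicateCol Unit (fun v => -c e * (groundedIncidence o v e : ℝ)) *
        replicateRow Unit (fun v => (groundedIncidence o v e : ℝ)) := by
  have hne : e ≠ s(o, o) := by rintro rfl; simp at he
  ext a b
  rw [Matrix.add_apply, groundedLaplacian_apply_eq_sum, groundedLaplacian_apply_eq_sum,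
    ← Finset.add_sum_erase _ _ (mem_univ e), ← Finset.add_sum_erase (a := e) _ _ (mem_univ e)]
  have h1 : groundedWeight G o (Function.update c e 0) e = 0 := by
    simp [groundedWeight, hne]
  have h2 : groundedWeight G o c e = c e := by simp [groundedWeight, hne, he]
  have h3 : ∀ f ∈ univ.erase e, groundedWeight G o (Function.update c e 0) f =
      groundedWeight G o c f := by
    intro f hf
    simp [groundedWeight, Function.update_of_ne (ne_of_mem_erase hf)]
  rw [h1, h2, Finset.sum_congr rfl fun f hf => by rw [h3 f hf]]
  simp [Matrix.mul_apply]
  ring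

theorem sum_spanningTreesThrough (e : Sym2 V) :
    ∑ T ∈ spanningTreesThrough G e, ∏ t ∈ T, c t = ∑ T ∈ spanningTrees G, ∏ t ∈ T, c t -
      ∑ T ∈ spanningTrees G, ∏ t ∈ T, Function.update c e 0 t := by
  have h : spanningTreesThrough G e = (spanningTrees G).filter (e ∈ ·) := by
    ext T
    simp [spanningTrees, spanningTreesThrough]
  rw [h, Finset.sum_filter, ← Finset.sum_sub_distrib]
  refine Finset.sum_congr rfl fun T _ => ?_
  split_ifs with hT
  · rw [Finset.prod_eq_zero hT (f := fun t => Function.update c e 0 t) (by simp), sub_zero]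
  · rw [Finset.prod_congr rfl fun t ht =>
      Function.update_of_ne (ne_of_mem_of_not_mem ht hT) 0 c, sub_self]

/-- The relative resistance of an edge is its weight times the effective resistance between its
ends. Setting the weight of the edge to zero is a rank one change of the grounded Laplacian, so
this follows from the matrix-tree theorem and the matrix determinant lemma. -/
theorem relativeResistance_eq (hG : G.Connected) {Γ : Matrix V V ℝ}
    (hΓ : groundedLaplacian G o c * Γ = 1) {a b : V} (hab : G.Adj a b) :
    relativeResistance G c s(a, b) = c s(a, b) * effectiveResistance Γ a b := by
  have hunit : IsUnit (groundedLaplacian G o c).det := isUnit_det_of_right_inverse hΓ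
  have hinv : (groundedLaplacian G o c)⁻¹ = Γ := inv_eq_right_inv hΓ
  have hsymm : Γ b a = Γ a b := by
    have h1 : (groundedLaplacian G o c)ᵀ = groundedLaplacian G o c := by
      ext x y
      exact groundedLaplacian_comm o c y x
    have h2 : Γᵀ = Γ := by rw [← hinv, transpose_nonsing_inv, h1]
    exact congrFun (congrFun h2 a) b
  have hne : s(a, b) ≠ s(o, o) := by
    intro h
    have : s(a, b) ∈ G.edgeSet := hab
    rw [h] at this
    simp at this
  have hquad : ∑ x, ∑ y, (groundedIncidence o y s(a, b) : ℝ) * Γ y x *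
      (groundedIncidence o x s(a, b) : ℝ) = effectiveResistance Γ a b := by
    rcases groundedIncidence_mk o hne with h | h <;>
      simp [h, Pi.single_apply, sub_mul, mul_sub, Finset.sum_sub_distrib, effectiveResistance,
        hsymm] <;> ring
  have hdet : (groundedLaplacian G o (Function.update c s(a, b) 0)).det =
      (groundedLaplacian G o c).det * (1 - c s(a, b) * effectiveResistance Γ a b) := by
    rw [groundedLaplacian_update o c hab, det_add_replicateCol_mul_replicateRow hunit, hinv,
      ← hquad]
    congr 1
    simp only [det_unique, Matrix.add_apply, Matrix.mul_apply, replicateRow_apply,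
      replicateCol_apply, Matrix.one_apply_eq, Finset.sum_mul, Finset.mul_sum, sub_eq_add_neg,
      ← Finset.sum_neg_distrib]
    congr 1
    exact Finset.sum_congr rfl fun x _ => Finset.sum_congr rfl fun y _ => by ring
  rw [relativeResistance, sum_spanningTreesThrough, ← det_groundedLaplacian hG o,
    ← det_groundedLaplacian hG o, hdet]
  have := hunit.ne_zero
  field_simp
  ring

theorem det_groundedLaplacian_pos (hG : G.Connected) (hc : ∀ e ∈ G.edgeSet, 0 < c e) :
    0 < (groundedLaplacian G o c).det := by
  rw [det_groundedLaplacian hG]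
  refine Finset.sum_pos (fun T hT => Finset.prod_pos fun t ht => hc t ?_) ?_
  · have hT' : IsSpanningTree G T := by simpa [spanningTrees] using hT
    exact hT'.1.1 ht
  · obtain ⟨T, hle, hT⟩ := hG.exists_isTree_le
    have hS : ((Set.toFinite T.edgeSet).toFinset : Set (Sym2 V)) = T.edgeSet := by simp
    refine ⟨(Set.toFinite T.edgeSet).toFinset, ?_⟩
    simp only [spanningTrees, Set.Finite.mem_toFinset, Set.mem_ofPred_eq]
    rw [isSpanningTree_iff_isTree hG, hS, SimpleGraph.fromEdgeSet_edgeSet]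
    exact ⟨SimpleGraph.edgeSet_mono hle, hT⟩

/-- The resistance curvature in terms of a Green matrix, as a sum over all vertices. -/
theorem curvature_eq (hG : G.Connected) {Γ : Matrix V V ℝ}
    (hΓ : groundedLaplacian G o c * Γ = 1) (v : V) :
    curvature G c v = 1 - 1 / 2 * ∑ u, conductance G c v u * effectiveResistance Γ v u := by
  classical
  have h : (Set.toFinite (G.incidenceSet v)).toFinset =
      (univ.filter (G.Adj v)).image (fun u => s(v, u)) := by
    ext e
    induction e with
    | h a b =>
      simp only [Set.Finite.mem_toFinset, SimpleGraph.mk'_mem_incidenceSet_iff, mem_image,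
        mem_filter, mem_univ, true_and]
      constructor
      · rintro ⟨hab, rfl | rfl⟩
        · exact ⟨b, hab, rfl⟩
        · exact ⟨a, hab.symm, Sym2.eq_swap⟩
      · rintro ⟨u, hu, h⟩
        rcases Sym2.eq_iff.1 h with ⟨rfl, rfl⟩ | ⟨rfl, rfl⟩
        · exact ⟨hu, Or.inl rfl⟩
        · exact ⟨hu.symm, Or.inr rfl⟩
  rw [curvature, h, Finset.sum_image fun x _ y _ hxy => Sym2.congr_right.1 hxy, Finset.sum_filter]
  congr 2
  refine Finset.sum_congr rfl fun u _ => ?_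
  by_cases hu : G.Adj v u
  · rw [if_pos hu, relativeResistance_eq o c hG hΓ hu, conductance, if_pos hu]
  · rw [if_neg hu, conductance, if_neg hu, zero_mul]

end

/-! ### Elimination of a vertex -/

/-- Adjacency in `kron G U`, as a relation on all vertices of `G`. -/
def KronAdj {V : Type*} (G : SimpleGraph V) (U : Set V) (a b : V) : Prop :=
  ∃ (ha : a ∉ U) (hb : b ∉ U), (kron G U).Adj ⟨a, ha⟩ ⟨b, hb⟩

theorem KronAdj.ne {V : Type*} {G : SimpleGraph V} {U : Set V} {a b : V}
    (h : KronAdj G U a b) : a ≠ b :=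
  let ⟨_, _, hab⟩ := h
  fun h' => hab.ne (Subtype.ext h')

theorem kronAdj_empty {V : Type*} (G : SimpleGraph V) (a b : V) :
    KronAdj G ∅ a b ↔ G.Adj a b := by
  constructor
  · rintro ⟨ha, hb, h⟩
    rcases ((kron_adj_iff G ∅ _ _).1 h).2 with h | ⟨_, _, _, _, h, _⟩
    · exact h
    · exact absurd h (Set.notMem_empty _)
  · intro h
    exact ⟨Set.notMem_empty a, Set.notMem_empty b, (kron_adj_iff G ∅ _ _).2
      ⟨fun h' => h.ne (congrArg Subtype.val h'), Or.inl h⟩⟩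

theorem kronAdj_insert {V : Type*} (G : SimpleGraph V) {U : Set V} {x : V} (hx : x ∉ U)
    (a b : V) : KronAdj G (insert x U) a b ↔
      a ≠ b ∧ a ≠ x ∧ b ≠ x ∧ (KronAdj G U a b ∨ KronAdj G U x a ∧ KronAdj G U x b) := by
  have hconn : ((kron G U).induce {⟨x, hx⟩}).Connected :=
    { preconnected := fun u v => by rw [Subsingleton.elim u v], nonempty := ⟨⟨_, rfl⟩⟩ }
  have hb : ∀ w : {v // v ∉ U}, w ≠ ⟨x, hx⟩ →
      (w ∈ boundary (kron G U) {⟨x, hx⟩} ↔ (kron G U).Adj ⟨x, hx⟩ w) := by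
    intro w hw
    constructor
    · rintro ⟨_, _, rfl, h⟩
      exact h
    · exact fun h => ⟨hw, _, rfl, h⟩
  have key : ∀ (ha : a ∉ U) (hb' : b ∉ U) (hax : a ≠ x) (hbx : b ≠ x)
      (ha' : a ∉ insert x U) (hb'' : b ∉ insert x U),
      (kron G (insert x U)).Adj ⟨a, ha'⟩ ⟨b, hb''⟩ ↔ a ≠ b ∧ ((kron G U).Adj ⟨a, ha⟩ ⟨b, hb'⟩ ∨
        (kron G U).Adj ⟨x, hx⟩ ⟨a, ha⟩ ∧ (kron G U).Adj ⟨x, hx⟩ ⟨b, hb'⟩) := by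
    intro ha hb' hax hbx ha' hb''
    have hau : (⟨a, ha⟩ : {v // v ∉ U}) ≠ ⟨x, hx⟩ := fun h => hax (congrArg Subtype.val h)
    have hbu : (⟨b, hb'⟩ : {v // v ∉ U}) ≠ ⟨x, hx⟩ := fun h => hbx (congrArg Subtype.val h)
    have h := kron_insert_adj G U x hx ⟨⟨a, ha⟩, hau⟩ ⟨⟨b, hb'⟩, hbu⟩
    rw [← h, kron_adj_of_connected _ _ hconn, hb _ hau, hb _ hbu]
    exact and_congr_left fun _ => not_congr
      ⟨fun h => congrArg (fun w => ((w : {v // v ∉ U}) : V)) (congrArg Subtype.val h),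
        fun h => by subst h; rfl⟩
  constructor
  · rintro ⟨ha', hb'', h⟩
    have ha : a ∉ U := fun h => ha' (Or.inr h)
    have hb' : b ∉ U := fun h => hb'' (Or.inr h)
    have hax : a ≠ x := fun h => ha' (Or.inl h)
    have hbx : b ≠ x := fun h => hb'' (Or.inl h)
    obtain ⟨hab, h⟩ := (key ha hb' hax hbx ha' hb'').1 h
    exact ⟨hab, hax, hbx, h.imp (fun h => ⟨ha, hb', h⟩) fun h => ⟨⟨hx, ha, h.1⟩, ⟨hx, hb', h.2⟩⟩⟩
  · rintro ⟨hab, hax, hbx, h⟩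
    have ha : a ∉ U := by rcases h with ⟨h, _, _⟩ | ⟨⟨_, h, _⟩, _⟩ <;> exact h
    have hb' : b ∉ U := by rcases h with ⟨_, h, _⟩ | ⟨_, ⟨_, h, _⟩⟩ <;> exact h
    have ha' : a ∉ insert x U := fun h => h.elim hax ha
    have hb'' : b ∉ insert x U := fun h => h.elim hbx hb'
    refine ⟨ha', hb'', (key ha hb' hax hbx ha' hb'').2 ⟨hab, h.imp ?_ ?_⟩⟩
    · rintro ⟨_, _, h⟩; exact h
    · rintro ⟨⟨_, _, h1⟩, ⟨_, _, h2⟩⟩; exact ⟨h1, h2⟩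

/-- The weights `c` on pairs of vertices realize `kron G U`: they are positive exactly on its
edges, `Γ` is a Green matrix of their Laplacian (with the root `o`) on the complement of `U`, and
all resistance curvatures, computed with the effective resistances of `Γ`, satisfy `P`. -/
structure IsKronWeight {V : Type*} [Fintype V] [DecidableEq V] (G : SimpleGraph V) (P : ℝ → Prop)
    (o : V) (Γ : V → V → ℝ) (U : Set V) (c : V → V → ℝ) : Prop where
  symm : ∀ a b, c a b = c b a
  pos : ∀ a b, KronAdj G U a b → 0 < c a b
  zero : ∀ a b, ¬ KronAdj G U a b → c a b = 0
  green : ∀ a ∉ U, ∀ w ∉ U, ∑ b, c a b * (Γ a w - Γ b w) =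
    (if a = w then 1 else 0) - if a = o then 1 else 0
  curv : ∀ a ∉ U, P (1 - 1 / 2 * ∑ b, c a b * effectiveResistance Γ a b)

/-- The weights obtained from `c` by eliminating the vertex `x` (the star-mesh transform). They
vanish on the diagonal and at `x`. -/
noncomputable def starMesh {V : Type*} [Fintype V] [DecidableEq V] (c : V → V → ℝ) (x : V)
    (a b : V) : ℝ :=
  if a = b ∨ a = x ∨ b = x then 0 else c a b + c x a * c x b / ∑ u, c x u

theorem sum_starMesh_mul {V : Type*} [Fintype V] [DecidableEq V] {c : V → V → ℝ} {x a : V}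
    (hax : a ≠ x) (hc : c x x = 0) {f : V → ℝ} (hf : f a = 0) :
    ∑ b, starMesh c x a b * f b =
      ∑ b, c a b * f b - c a x * f x + c x a / (∑ u, c x u) * ∑ b, c x b * f b := by
  have h : ∀ b, starMesh c x a b * f b = c a b * f b - (if b = x then c a x * f x else 0) +
      c x a / (∑ u, c x u) * (c x b * f b) := by
    intro b
    rcases eq_or_ne b x with rfl | hbx
    · simp [starMesh, hc]
    · rcases eq_or_ne a b with rfl | hab
      · simp [hf, hax]
      · simp only [starMesh, hab, hax, hbx, or_self, if_false]
        ring
  rw [Finset.sum_congr rfl fun b _ => h b, Finset.sum_add_distrib, Finset.sum_sub_distrib,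
    ← Finset.mul_sum]
  simp

/-- Elimination of a vertex `x` changes the curvature at `a` to `p a + (c x a / d) * p x`, where
`d` is the total weight at `x`. -/
theorem IsKronWeight.starMesh {V : Type*} [Fintype V] [DecidableEq V] {G : SimpleGraph V}
    {P : ℝ → Prop} {o : V} {Γ : V → V → ℝ} {U : Set V} {c : V → V → ℝ}
    (hP : ∀ p q t : ℝ, P p → P q → 0 ≤ t → P (p + t * q)) (hΓ : ∀ a b, Γ a b = Γ b a)
    (h : IsKronWeight G P o Γ U c) {x : V} (hx : x ∉ U) (hxo : x ≠ o) :
    IsKronWeight G P o Γ (insert x U) (starMesh c x) := by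
  have hnonneg : ∀ a b, 0 ≤ c a b := by
    intro a b
    by_cases hab : KronAdj G U a b
    · exact (h.pos a b hab).le
    · exact (h.zero a b hab).ge
  have hcxx : c x x = 0 := h.zero x x fun h => h.ne rfl
  have hd : 0 < ∑ u, c x u := by
    refine (Finset.sum_nonneg fun u _ => hnonneg x u).lt_of_ne fun h0 => ?_
    -- a vertex of total weight zero contradicts the Green identity at `(x, x)`
    have hz := (Finset.sum_eq_zero_iff_of_nonneg fun u _ => hnonneg x u).1 h0.symm
    have := h.green x hx x hx
    rw [Finset.sum_eq_zero fun b hb => by rw [hz b hb, zero_mul]] at this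
    simp [hxo] at this
  set d := ∑ u, c x u with hd_def
  have hsum : ∀ w ∉ U, ∀ t : ℝ, ∑ b, c x b * (t - Γ b w) =
      d * (t - Γ x w) + if x = w then 1 else 0 := by
    intro w hw t
    have h1 : ∀ b, c x b * (t - Γ b w) = c x b * (t - Γ x w) + c x b * (Γ x w - Γ b w) :=
      fun b => by ring
    rw [Finset.sum_congr rfl fun b _ => h1 b, Finset.sum_add_distrib, ← Finset.sum_mul,
      h.green x hx w hw, if_neg hxo, sub_zero]
  refine ⟨fun a b => ?_, fun a b hab => ?_, fun a b hab => ?_, fun a ha w hw => ?_,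
    fun a ha => ?_⟩
  · simp only [ResistanceGraph.starMesh, h.symm a b, mul_comm (c x a)]
    exact if_congr (by grind) rfl rfl
  · obtain ⟨h1, h2, h3, h4⟩ := (kronAdj_insert G hx a b).1 hab
    rw [ResistanceGraph.starMesh, if_neg (by tauto)]
    rcases h4 with h4 | ⟨h4, h5⟩
    · exact add_pos_of_pos_of_nonneg (h.pos a b h4)
        (div_nonneg (mul_nonneg (hnonneg _ _) (hnonneg _ _)) hd.le)
    · exact add_pos_of_nonneg_of_pos (hnonneg _ _)
        (div_pos (mul_pos (h.pos _ _ h4) (h.pos _ _ h5)) hd)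
  · rw [ResistanceGraph.starMesh]
    split_ifs with h1
    · rfl
    · rw [kronAdj_insert G hx a b] at hab
      have h2 : c a b = 0 := h.zero a b (by tauto)
      have h3 : c x a * c x b = 0 := by
        by_cases hxa : KronAdj G U x a
        · rw [h.zero x b (by tauto), mul_zero]
        · rw [h.zero x a hxa, zero_mul]
      rw [h2, h3, zero_div, add_zero]
  · have haU : a ∉ U := fun h => ha (Or.inr h)
    have hax : a ≠ x := fun h => ha (Or.inl h)
    have hwU : w ∉ U := fun h => hw (Or.inr h)
    have hwx : w ≠ x := fun h => hw (Or.inl h)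
    rw [sum_starMesh_mul hax hcxx (sub_self _), h.green a haU w hwU, hsum w hwU,
      if_neg hwx.symm, h.symm a x, ← hd_def]
    field_simp
    ring
  · have haU : a ∉ U := fun h => ha (Or.inr h)
    have hax : a ≠ x := fun h => ha (Or.inl h)
    have hR : effectiveResistance Γ a a = 0 := by simp only [effectiveResistance]; ring
    have hRx : ∑ b, c x b * effectiveResistance Γ x b =
        2 - ∑ b, c x b * (Γ x x - Γ b b) := by
      have h1 : ∀ b, c x b * effectiveResistance Γ x b =
          2 * (c x b * (Γ x x - Γ b x)) - c x b * (Γ x x - Γ b b) := by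
        intro b
        rw [effectiveResistance, hΓ x b]
        ring
      rw [Finset.sum_congr rfl fun b _ => h1 b, Finset.sum_sub_distrib, ← Finset.mul_sum,
        h.green x hx x hx]
      simp [hxo]
    have hRa : ∑ b, c x b * effectiveResistance Γ a b =
        d * effectiveResistance Γ a x - ∑ b, c x b * (Γ x x - Γ b b) := by
      have h1 : ∀ b, c x b * effectiveResistance Γ a b = c x b * effectiveResistance Γ a x -
          c x b * (Γ x x - Γ b b) + 2 * (c x b * (Γ x a - Γ b a)) := by
        intro b
        simp only [effectiveResistance, hΓ a x, hΓ a b]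
        ring
      rw [Finset.sum_congr rfl fun b _ => h1 b, Finset.sum_add_distrib, Finset.sum_sub_distrib,
        ← Finset.mul_sum, ← Finset.sum_mul, h.green x hx a haU]
      simp [hxo, hax.symm, hd_def]
    have := hP _ _ (c x a / d) (h.curv a haU) (h.curv x hx) (div_nonneg (hnonneg _ _) hd.le)
    rw [hRx] at this
    rw [sum_starMesh_mul hax hcxx hR, ← hd_def, hRa, h.symm a x]
    convert this using 1
    field_simp
    ring

theorem exists_isKronWeight {V : Type*} [Fintype V] [DecidableEq V] {G : SimpleGraph V}
    {P : ℝ → Prop} {o : V} {Γ : V → V → ℝ} {c : V → V → ℝ}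
    (hP : ∀ p q t : ℝ, P p → P q → 0 ≤ t → P (p + t * q)) (hΓ : ∀ a b, Γ a b = Γ b a)
    (h : IsKronWeight G P o Γ ∅ c) {U : Set V} (hU : o ∉ U) :
    ∃ c', IsKronWeight G P o Γ U c' := by
  induction U, Set.toFinite U using Set.Finite.induction_on with
  | empty => exact ⟨c, h⟩
  | @insert x U hx _ ih =>
    obtain ⟨c', hc'⟩ := ih fun h => hU (Or.inr h)
    exact ⟨_, hc'.starMesh hP hΓ hx fun h => hU (Or.inl h.symm)⟩

/-! ### Kron reduction and curvature -/

/-- A condition `P` on the resistance curvatures passes to Kron reductions if it is stable under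
adding nonnegative multiples of values satisfying it. -/
theorem exists_curvature_kron {V : Type*} [Finite V] {G : SimpleGraph V} (hG : G.Connected)
    (U : Set V) {P : ℝ → Prop} (hP : ∀ p q t : ℝ, P p → P q → 0 ≤ t → P (p + t * q))
    (h : ∃ c : Sym2 V → ℝ, (∀ e ∈ G.edgeSet, 0 < c e) ∧ ∀ v, P (curvature G c v)) :
    ∃ c : Sym2 {v // v ∉ U} → ℝ,
      (∀ e ∈ (kron G U).edgeSet, 0 < c e) ∧ ∀ v, P (curvature (kron G U) c v) := by
  classical
  have := Fintype.ofFinite V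
  obtain ⟨c, hc, hcurv⟩ := h
  -- without a remaining vertex there is no root, and nothing to prove
  by_cases hU : U = Set.univ
  · have hempty : IsEmpty {v // v ∉ U} := ⟨fun v => v.2 (hU.ge (Set.mem_univ v.1))⟩
    refine ⟨fun _ => 1, fun _ _ => one_pos, fun v => hempty.elim v⟩
  obtain ⟨o, ho⟩ := (Set.ne_univ_iff_exists_notMem U).1 hU
  have hunit : IsUnit (groundedLaplacian G o c).det :=
    (det_groundedLaplacian_pos o c hG hc).ne'.isUnit
  set Γ := (groundedLaplacian G o c)⁻¹ with hΓ_def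
  have hΓ : groundedLaplacian G o c * Γ = 1 := mul_nonsing_inv _ hunit
  have hsymm : ∀ a b, Γ a b = Γ b a := by
    have h1 : (groundedLaplacian G o c)ᵀ = groundedLaplacian G o c := by
      ext x y
      exact groundedLaplacian_comm o c y x
    have h2 : Γᵀ = Γ := by rw [hΓ_def, transpose_nonsing_inv, h1]
    exact fun a b => congrFun (congrFun h2 b) a
  have hgreen : ∀ a w, (∑ b, conductance G c a b * (Γ a w - Γ b w)) +
      (if a = o then Γ a w else 0) = if a = w then 1 else 0 := by
    intro a w
    rw [← sum_groundedLaplacian_mul o c (fun b => Γ b w), ← Matrix.mul_apply, hΓ,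
      Matrix.one_apply]
  -- summing the Green identity over all vertices, the Laplacian part cancels
  have hroot : ∀ w, Γ o w = 1 := by
    intro w
    have h1 := Finset.sum_congr rfl fun a (_ : a ∈ (univ : Finset V)) => hgreen a w
    have h2 : ∑ a, ∑ b, conductance G c a b * (Γ a w - Γ b w) = 0 := by
      have h3 : ∑ a, ∑ b, conductance G c a b * (Γ a w - Γ b w) =
          -∑ a, ∑ b, conductance G c a b * (Γ a w - Γ b w) := by
        conv_lhs => rw [Finset.sum_comm]
        simp only [← Finset.sum_neg_distrib]
        refine Finset.sum_congr rfl fun a _ => Finset.sum_congr rfl fun b _ => ?_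
        rw [conductance_comm]
        ring
      linarith
    rw [Finset.sum_add_distrib, h2] at h1
    simpa using h1
  have hstart : IsKronWeight G P o Γ ∅ (conductance G c) := by
    refine ⟨conductance_comm G c, fun a b hab => ?_, fun a b hab => ?_, fun a _ w _ => ?_,
      fun a _ => ?_⟩
    · rw [kronAdj_empty] at hab
      rw [conductance, if_pos hab]
      exact hc _ hab
    · rw [kronAdj_empty] at hab
      rw [conductance, if_neg hab]
    · rw [← hgreen a w]
      by_cases hao : a = o
      · simp [hao, hroot]
      · simp [hao]
    · rw [← curvature_eq o c hG hΓ]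
      exact hcurv a
  obtain ⟨k, hk⟩ := exists_isKronWeight hP hsymm hstart ho
  have hK : (kron G U).Connected := kron_connected G hG U hU
  let c' : Sym2 {v // v ∉ U} → ℝ :=
    Sym2.lift ⟨fun a b => k a b, fun a b => hk.symm a b⟩
  have hcond : ∀ a b : {v // v ∉ U}, conductance (kron G U) c' a b = k a b := by
    intro a b
    rw [conductance]
    split_ifs with hab
    · rfl
    · exact (hk.zero a b fun ⟨_, _, h⟩ => hab h).symm
  have hsumU : ∀ (a : {v // v ∉ U}) (f : V → ℝ),
      ∑ b : {v // v ∉ U}, k a b * f b = ∑ b, k a b * f b := by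
    intro a f
    refine Finset.sum_bij_ne_zero (fun b _ _ => (b : V)) (fun _ _ _ => mem_univ _)
      (fun _ _ _ _ _ _ h => Subtype.ext h) (fun b _ hb => ?_) (fun _ _ _ => rfl)
    have hb' : b ∉ U := by
      intro hbU
      refine hb ?_
      rw [hk.zero a b fun ⟨_, h, _⟩ => h hbU, zero_mul]
    exact ⟨⟨b, hb'⟩, mem_univ _, hb, rfl⟩
  let Γ' : Matrix {v // v ∉ U} {v // v ∉ U} ℝ := fun a b => Γ a b
  have hΓ' : groundedLaplacian (kron G U) ⟨o, ho⟩ c' * Γ' = 1 := by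
    ext a w
    rw [Matrix.mul_apply, sum_groundedLaplacian_mul _ _ (fun b => Γ' b w), Matrix.one_apply]
    simp only [hcond, Γ']
    rw [hsumU a fun b => Γ a w - Γ b w, hk.green a a.2 w w.2]
    by_cases hao : a = ⟨o, ho⟩
    · subst hao
      simp [hroot, Subtype.ext_iff]
    · have hao' : (a : V) ≠ o := fun h => hao (Subtype.ext h)
      simp [hao, hao', Subtype.ext_iff]
  refine ⟨c', fun e => ?_, fun v => ?_⟩
  · induction e with
    | h a b => exact fun hab => hk.pos a b ⟨a.2, b.2, hab⟩
  · have hcv := curvature_eq (G := kron G U) (Γ := Γ') ⟨o, ho⟩ c' hK hΓ' v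
    rw [hcv]
    simp only [hcond]
    have := hk.curv v v.2
    rw [← hsumU v fun b => effectiveResistance Γ v b] at this
    exact this

end ResistanceGraph

theorem mainTheorem8 {V : Type*} [Finite V] (G : SimpleGraph V) (hG : G.Connected) (U : Set V) :
    (ResistanceGraph.IsRN G → ResistanceGraph.IsRN (ResistanceGraph.kron G U)) ∧
      (ResistanceGraph.IsRP G → ResistanceGraph.IsRP (ResistanceGraph.kron G U)) :=
  ⟨ResistanceGraph.exists_curvature_kron hG U fun _ _ _ hp hq ht =>
      add_nonneg hp (mul_nonneg ht hq),
    ResistanceGraph.exists_curvature_kron hG U fun _ _ _ hp hq ht =>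
      add_pos_of_pos_of_nonneg hp (mul_nonneg ht (le_of_lt hq))⟩
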